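/- Let $\mathsf{Brw}$ be the set of Brouwer ordinals: the quotient inductive-inductive set, generated together with a proposition-valued relation $\le$, with constructors $\mathsf{zero}$, $\mathsf{suc}\,x$, and $\mathsf{lim}\,f$ for every sequence $f:\mathbb N\to\mathsf{Brw}$ that is strictly increasing ($\mathsf{suc}\,(f_n)\le f_{n+1}$ for all $n$); a path constructor $\mathsf{lim}\,f=\mathsf{lim}\,g$ whenever $\forall n\,\exists m\; f_n\le g_m$ and $\forall n\,\exists m\; g_n\le f_m$; and the following rules for $\le$: $\mathsf{zero}\le x$; transitivity; $x\le y$ implies $\mathsf{suc}\,x\le\mathsf{suc}\,y$; $x\le f_n$ implies $x\le\mathsf{lim}\,f$; and if $f_n\le x$ for all $n$, then $\mathsf{lim}\,f\le x$. For natural numbers $k$ and $n$ the ordinal $\omega\cdot k+n$ is given by $\omega\cdot 0=\mathsf{zero}$, $\omega\cdot(k+1)=\mathsf{lim}_i(\omega\cdot k+i)$, $x+0=x$ and $x+(n+1)=\mathsf{suc}(x+n)$. A proposition $P$ is called $\alpha$-decidable, for $\alpha$ in $\mathsf{Brw}$, if there exists $y$ in $\mathsf{Brw}$ such that $P\leftrightarrow\alpha\le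 y$. Theorem. For all natural numbers $k$ and $n$, the $(\omega\cdot k+n)$-decidable propositions are closed under binary disjunction: if $P$ and $Q$ are $(\omega\cdot k+n)$-decidable, then so is $P\vee Q$. The theorem is understood constructively, without excluded middle or any choice principle: it holds in the internal logic of the topos of sheaves on every site $(C,J)$. Explicitly, in Kripke–Joyal semantics, for every object $c$ of $C$ and all $J$-closed sieves $P,Q$ on $c$ (the propositions at stage $c$): if $c$ forces that $P$ is $(\omega\cdot k+n)$-decidable and that $Q$ is $(\omega\cdot k+n)$-decidable, then $c$ forces that $P\vee Q$, the $J$-closure of the union $P\cup Q$, is $(\omega\cdot k+n)$-decidable. Here $\mathsf{Brw}$ and $\le$ are the quotient inductive-inductive sheaf and relation generated by the constructors above, and $\exists$ means existence on a $J$-cover. For the one-point site this is the statement in its ordinary set-theoretic reading. -/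

import Mathlib

/-!
Brouwer ordinals and ordinal decidability, read constructively.

Classically every true proposition and every false proposition is `α`-decidable for trivial reasons
(`α ≠ 0`), so the notions are interpreted here where constructive mathematics lives: in the internal
logic of the topos of sheaves on an arbitrary site `(C, J)`, by Kripke-Joyal forcing.
An object `c : C` is a stage; a proposition at stage `c` is a `J`-closed sieve on `c` (an element of
`Ω c` for the subobject classifier `Ω`, `CategoryTheory.Functor.closedSieves`); `∃` and `∨` mean
local existence, that is, existence on a `J`-cover. For the one-point site with its trivial topology
this is the ordinary meaning of all the notions.
-/

open CategoryTheory

universe v u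

namespace Brouwer

variable {C : Type u} [Category.{v} C]

/-- Names for the elements, at stage `c`, of the sheaf `Brw` of Brouwer ordinals: the point
constructors `zero`, `suc`, `lim`, and amalgamation (`glue`) of a family of local names indexed by a
covering sieve. Which names denote (limits are allowed only of strictly increasing sequences,
amalgamations only of matching families), and which names are equal or comparable, is determined by
`Brouwer.Forces`. -/
inductive Name (J : GrothendieckTopology C) : C → Type (max u v) where
  | zero {c : C} : Name J c
  | suc {c : C} (x : Name J c) : Name J c
  | lim {c : C} (s : ℕ → Name J c) : Name J c
  | glue {c : C} (S : Sieve c) (hS : S ∈ J c) (x : ∀ (d : C) (f : d ⟶ c), S f → Name J d) : Name J c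

namespace Name

variable {J : GrothendieckTopology C}

/-- The restriction of a name at stage `c` along a morphism `d ⟶ c`. -/
def restrict {c : C} (x : Name J c) {d : C} (g : d ⟶ c) : Name J d :=
  match x with
  | zero => zero
  | suc x => suc (x.restrict g)
  | lim s => lim (fun n => (s n).restrict g)
  | glue S hS x =>
      glue (S.pullback g) (J.pullback_stable g hS) (fun e f hf => x e (f ≫ g) hf)

/-- `x + n` for a natural number `n`. -/
def addNat {c : C} (x : Name J c) : ℕ → Name J c
  | 0 => x
  | n + 1 => suc (x.addNat n)

/-- `ω · k` for a natural number `k`: `ω · 0 = 0` and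
`ω · (k + 1) = ω · k + ω = lim (n ↦ ω · k + n)`. -/
def omegaMul {c : C} : ℕ → Name J c
  | 0 => zero
  | k + 1 => lim (fun n => (omegaMul k).addNat n)

end Name

/-- The atomic statements about `Brw` at stage `c`: the name `x` denotes an element; the elements
denoted by `x` and `y` are equal; the element denoted by `x` is `≤` the one denoted by `y`. -/
inductive Atom (J : GrothendieckTopology C) (c : C) : Type (max u v) where
  | defined (x : Name J c) : Atom J c
  | equal (x y : Name J c) : Atom J c
  | le (x y : Name J c) : Atom J c

/-- The restriction of an atomic statement along a morphism. -/
def Atom.restrict {J : GrothendieckTopology C} {c : C} (a : Atom J c) {d : C} (g : d ⟶ c) :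
    Atom J d :=
  match a with
  | defined x => defined (x.restrict g)
  | equal x y => equal (x.restrict g) (y.restrict g)
  | le x y => le (x.restrict g) (y.restrict g)

open Name Atom

/-- `Forces J c a`: the atomic statement `a` holds at stage `c`. This is the quotient
inductive-inductive definition of `Brw` and `≤` in the topos of sheaves on `(C, J)`: the elements of
`Brw` at stage `c` are the `defined` names up to `equal`, and all three judgements are generated
simultaneously by the rules below and nothing else. -/
inductive Forces (J : GrothendieckTopology C) : (c : C) → Atom J c → Prop where
  -- Statements that hold at a stage hold at all later stages.
  | restrict {c : C} {a : Atom J c} {d : C} (g : d ⟶ c) :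
      Forces J c a → Forces J d (a.restrict g)
  -- The point constructors; `lim` accepts the sequences with `s n < s (n + 1)` for all `n`.
  | zero_defined {c : C} : Forces J c (defined zero)
  | suc_defined {c : C} {x : Name J c} : Forces J c (defined x) → Forces J c (defined (suc x))
  | lim_defined {c : C} {s : ℕ → Name J c} :
      (∀ n, Forces J c (defined (s n))) → (∀ n, Forces J c (le (suc (s n)) (s (n + 1)))) →
      Forces J c (defined (lim s))
  -- Matching families of local elements have amalgamations.
  | glue_defined {c : C} {S : Sieve c} {hS : S ∈ J c}
      {x : ∀ (d : C) (f : d ⟶ c), S f → Name J d} :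
      (∀ (d : C) (f : d ⟶ c) (hf : S f), Forces J d (defined (x d f hf))) →
      (∀ (d : C) (f : d ⟶ c) (hf : S f) (e : C) (g : e ⟶ d),
        Forces J e (equal ((x d f hf).restrict g) (x e (g ≫ f) (S.downward_closed hf g)))) →
      Forces J c (defined (glue S hS x))
  | glue_eq {c : C} {S : Sieve c} {hS : S ∈ J c}
      {x : ∀ (d : C) (f : d ⟶ c), S f → Name J d} :
      Forces J c (defined (glue S hS x)) → ∀ (d : C) (f : d ⟶ c) (hf : S f),
      Forces J d (equal ((glue S hS x).restrict f) (x d f hf))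
  -- Equality is a congruence and is local.
  | eq_refl {c : C} {x : Name J c} : Forces J c (defined x) → Forces J c (equal x x)
  | eq_symm {c : C} {x y : Name J c} : Forces J c (equal x y) → Forces J c (equal y x)
  | eq_trans {c : C} {x y z : Name J c} :
      Forces J c (equal x y) → Forces J c (equal y z) → Forces J c (equal x z)
  | suc_eq {c : C} {x y : Name J c} : Forces J c (equal x y) → Forces J c (equal (suc x) (suc y))
  | eq_local {c : C} {x y : Name J c} {S : Sieve c} (hS : S ∈ J c) :
      Forces J c (defined x) → Forces J c (defined y) →
      (∀ (d : C) (f : d ⟶ c), S f → Forces J d (equal (x.restrict f) (y.restrict f))) →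
      Forces J c (equal x y)
  -- The path constructor `bisim`: if `∀ n, ∃ m, s n ≤ t m` and `∀ n, ∃ m, t n ≤ s m`, then
  -- `lim s = lim t`. The existential quantifiers are local: for each `n`, a witness is given on
  -- each member of a covering sieve.
  | bisim {c : C} {s t : ℕ → Name J c} (S T : ℕ → Sieve c)
      (hS : ∀ n, S n ∈ J c) (hT : ∀ n, T n ∈ J c)
      (i : ∀ (n : ℕ) (d : C) (f : d ⟶ c), S n f → ℕ)
      (j : ∀ (n : ℕ) (d : C) (f : d ⟶ c), T n f → ℕ) :
      Forces J c (defined (lim s)) → Forces J c (defined (lim t)) →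
      (∀ (n : ℕ) (d : C) (f : d ⟶ c) (hf : S n f),
        Forces J d (le ((s n).restrict f) ((t (i n d f hf)).restrict f))) →
      (∀ (n : ℕ) (d : C) (f : d ⟶ c) (hf : T n f),
        Forces J d (le ((t n).restrict f) ((s (j n d f hf)).restrict f))) →
      Forces J c (equal (lim s) (lim t))
  -- The relation `≤` is a relation on elements (it respects equality) and is local.
  | le_congr {c : C} {x x' y y' : Name J c} :
      Forces J c (equal x x') → Forces J c (equal y y') → Forces J c (le x y) → Forces J c (le x' y')
  | le_local {c : C} {x y : Name J c} {S : Sieve c} (hS : S ∈ J c) :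
      Forces J c (defined x) → Forces J c (defined y) →
      (∀ (d : C) (f : d ⟶ c), S f → Forces J d (le (x.restrict f) (y.restrict f))) →
      Forces J c (le x y)
  -- The constructors of `≤`.
  | le_trans {c : C} {x y z : Name J c} :
      Forces J c (le x y) → Forces J c (le y z) → Forces J c (le x z)
  | zero_le {c : C} {x : Name J c} : Forces J c (defined x) → Forces J c (le zero x)
  | suc_le_suc {c : C} {x y : Name J c} : Forces J c (le x y) → Forces J c (le (suc x) (suc y))
  | le_lim {c : C} {x : Name J c} {s : ℕ → Name J c} (n : ℕ) :
      Forces J c (defined (lim s)) → Forces J c (le x (s n)) → Forces J c (le x (lim s))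
  | lim_le {c : C} {x : Name J c} {s : ℕ → Name J c} :
      Forces J c (defined (lim s)) → (∀ n, Forces J c (le (s n) x)) → Forces J c (le (lim s) x)

/-- `OrdDecidable J α P`: stage `c` forces that the proposition `P` is `α`-decidable,
`∃ y : Brw, (P ↔ α ≤ y)`. -/
def OrdDecidable (J : GrothendieckTopology C) {c : C} (α : Name J c) (P : Sieve c) : Prop :=
  ∃ S ∈ J c, ∀ (d : C) (f : d ⟶ c), S f →
    ∃ y : Name J d, Forces J d (defined y) ∧
      ∀ (e : C) (g : e ⟶ d), P (g ≫ f) ↔ Forces J e (le (α.restrict (g ≫ f)) (y.restrict g))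

end Brouwer

/-! Two facts carry the theorem. If `x` is zero or a limit and `x ≤ y + n`, then `x ≤ y`, because
the sequence of a limit is strictly increasing. And `ω·(k+1) ≤ lim s` holds exactly when, locally,
`ω·k ≤ s i` for some `i`, since strict increase supplies the remaining finite steps.

Locally every element is `a + m` with `a` zero or a limit. For thresholds `ω·k` a disjunction is
therefore represented by a join built by recursion on `k` (`IsJoin`). At level 0 it is zero. At
level `k + 1`, with bases `a`, `b` of `y`, `z`, it is zero if both are zero, and otherwise the limit
of `h i + i`, where `h i` is the level-`k` join of the `i`-th terms of `a` and `b`. The lemmas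
`omegaMul_below_of_left` and `locally_or` show that the join is above `ω·k` exactly when, locally,
`y` or `z` is. Bases exist only locally, but the join is monotone (`IsJoin.mono`), hence unique, so
local joins glue (`IsJoin.exists_of_locally`) and the sequence `h` needs no internal countable
choice. The threshold `ω·k + (n + 1)` reduces to `ω·(k + 1)`, as locally the two decide the same
propositions.

Inverting inequalities is impossible with `Forces`, where transitivity is a generator. The cut-free
order `Below` allows it; `forces_le_iff` identifies the two orders on denoting names, and
antisymmetry (`Equiv.forces`) provides the equalities needed for gluing. -/

namespace Brouwer

variable {C : Type u} [Category.{v} C] {J : GrothendieckTopology C}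

/-! ### Functoriality of restriction of names -/

namespace Name

theorem glue_congr {c : C} {S S' : Sieve c} {hS : S ∈ J c} {hS' : S' ∈ J c}
    {x : ∀ (d : C) (f : d ⟶ c), S f → Name J d} {x' : ∀ (d : C) (f : d ⟶ c), S' f → Name J d}
    (h : S = S') (hx : ∀ d f hf hf', x d f hf = x' d f hf') : glue S hS x = glue S' hS' x' := by
  subst h
  congr 1
  funext d f hf
  exact hx d f hf hf

theorem family_congr {c : C} {S : Sieve c} (x : ∀ (d : C) (f : d ⟶ c), S f → Name J d)
    {d : C} {f g : d ⟶ c} (h : f = g) (hf : S f) (hg : S g) : x d f hf = x d g hg := by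
  subst h
  rfl

@[simp]
theorem restrict_id {c : C} (x : Name J c) : x.restrict (𝟙 c) = x := by
  induction x with
  | zero => rfl
  | suc x ih => simp [restrict, ih]
  | lim s ih => simp [restrict, ih]
  | glue S hS x _ =>
    exact glue_congr (Sieve.pullback_id) fun d f hf hf' => family_congr x (Category.comp_id f) _ _

@[simp]
theorem restrict_restrict {c : C} (x : Name J c) {d e : C} (f : d ⟶ c) (g : e ⟶ d) :
    (x.restrict f).restrict g = x.restrict (g ≫ f) := by
  induction x generalizing d e with
  | zero => rfl
  | suc x ih => simp [restrict, ih]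
  | lim s ih => simp [restrict, ih]
  | glue S hS x _ =>
    exact glue_congr (Sieve.pullback_comp ..).symm fun d f hf hf' =>
      family_congr x (Category.assoc ..) _ _

@[simp]
theorem restrict_addNat {c : C} (x : Name J c) (n : ℕ) {d : C} (f : d ⟶ c) :
    (x.addNat n).restrict f = (x.restrict f).addNat n := by
  induction n with
  | zero => rfl
  | succ n ih => simp [addNat, restrict, ih]

@[simp]
theorem restrict_omegaMul (k : ℕ) {c d : C} (f : d ⟶ c) :
    (omegaMul k : Name J c).restrict f = omegaMul k := by
  induction k with
  | zero => rfl
  | succ k ih => simp [omegaMul, restrict, ih]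

@[simp] theorem restrict_zero {c d : C} (f : d ⟶ c) : (zero : Name J c).restrict f = zero := rfl

@[simp] theorem restrict_suc {c d : C} (x : Name J c) (f : d ⟶ c) :
    (suc x).restrict f = suc (x.restrict f) := rfl

@[simp] theorem restrict_lim {c d : C} (s : ℕ → Name J c) (f : d ⟶ c) :
    (lim s).restrict f = lim (fun n => (s n).restrict f) := rfl

end Name

/-! ### Local truth -/

/-- `P` holds on the members of a covering sieve of `c`. -/
def Locally (J : GrothendieckTopology C) (c : C) (P : ∀ d : C, (d ⟶ c) → Prop) : Prop :=
  ∃ S ∈ J c, ∀ (d : C) (f : d ⟶ c), S f → P d f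

namespace Locally

variable {c : C} {P Q : ∀ d : C, (d ⟶ c) → Prop}

theorem of_forall (h : ∀ d f, P d f) : Locally J c P := ⟨⊤, J.top_mem c, fun d f _ => h d f⟩

theorem of_bot (h : ⊥ ∈ J c) : Locally J c P := ⟨⊥, h, fun _ _ hf => hf.elim⟩

theorem mono (h : Locally J c P) (hPQ : ∀ d f, P d f → Q d f) : Locally J c Q :=
  let ⟨S, hS, hP⟩ := h
  ⟨S, hS, fun d f hf => hPQ d f (hP d f hf)⟩

theorem and (h : Locally J c P) (h' : Locally J c Q) : Locally J c fun d f => P d f ∧ Q d f :=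
  let ⟨S, hS, hP⟩ := h
  let ⟨T, hT, hQ⟩ := h'
  ⟨S ⊓ T, J.intersection_covering hS hT, fun d f hf => ⟨hP d f hf.1, hQ d f hf.2⟩⟩

theorem restrict (h : Locally J c P) {d : C} (f : d ⟶ c) :
    Locally J d fun e g => P e (g ≫ f) :=
  let ⟨S, hS, hP⟩ := h
  ⟨S.pullback f, J.pullback_stable f hS, fun e g hg => hP e (g ≫ f) hg⟩

theorem join (h : Locally J c fun d f => Locally J d fun e g => P e (g ≫ f)) : Locally J c P := by
  obtain ⟨S, hS, h⟩ := h
  choose T hT hP using h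
  refine ⟨Sieve.bind S T, J.bind_covering hS fun d f hf => hT d f hf, ?_⟩
  rintro e _ ⟨d, g, f, hf, hg, rfl⟩
  exact hP d f hf e g hg

theorem bind (h : Locally J c P)
    (hPQ : ∀ d f, P d f → Locally J d fun e g => Q e (g ≫ f)) : Locally J c Q :=
  join (h.mono hPQ)

/-- A stage covered by the empty sieve forces everything, so `⊥ ∈ J c` plays the role of falsity in
all later contradictions. It is local because covers compose. -/
theorem bot_mem (h : Locally J c fun d _ => ⊥ ∈ J d) : ⊥ ∈ J c := by
  have : Locally J c fun _ _ => False := join (h.mono fun d f h => of_bot h)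
  obtain ⟨S, hS, h⟩ := this
  convert hS
  ext d f
  exact ⟨fun h => h.elim, h d f⟩

end Locally

theorem bot_mem_of_hom {c d : C} (f : d ⟶ c) (h : ⊥ ∈ J c) : ⊥ ∈ J d := by
  refine Locally.bot_mem ⟨_, J.pullback_stable f h, fun _ _ hg => hg.elim⟩

open Name

/-! ### The cut-free order -/

/-- A syntax-directed presentation of the order on names. -/
inductive Below {J : GrothendieckTopology C} : {c : C} → Name J c → Name J c → Prop where
  | zero {c : C} {y : Name J c} : Below .zero y
  | lim {c : C} {s : ℕ → Name J c} {y : Name J c} : (∀ n, Below (s n) y) → Below (.lim s) y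
  | glue {c : C} {S : Sieve c} {hS : S ∈ J c} {x : ∀ (d : C) (f : d ⟶ c), S f → Name J d}
      {y : Name J c} (T : Sieve c) (hT : T ∈ J c) (hTS : ∀ (d : C) (f : d ⟶ c), T f → S f) :
      (∀ (d : C) (f : d ⟶ c) (hf : T f), Below (x d f (hTS d f hf)) (y.restrict f)) →
      Below (.glue S hS x) y
  | suc_zero {c : C} {x : Name J c} : ⊥ ∈ J c → Below (.suc x) .zero
  | suc_suc {c : C} {x y : Name J c} : Below x y → Below (.suc x) (.suc y)
  | suc_lim {c : C} {x : Name J c} {s : ℕ → Name J c} (T : Sieve c) (hT : T ∈ J c)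
      (i : ∀ (d : C) (f : d ⟶ c), T f → ℕ) :
      (∀ (d : C) (f : d ⟶ c) (hf : T f),
        Below (.suc (x.restrict f)) ((s (i d f hf)).restrict f)) →
      Below (.suc x) (.lim s)
  | suc_glue {c : C} {x : Name J c} {S : Sieve c} {hS : S ∈ J c}
      {y : ∀ (d : C) (f : d ⟶ c), S f → Name J d}
      (T : Sieve c) (hT : T ∈ J c) (hTS : ∀ (d : C) (f : d ⟶ c), T f → S f) :
      (∀ (d : C) (f : d ⟶ c) (hf : T f), Below (.suc (x.restrict f)) (y d f (hTS d f hf))) →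
      Below (.suc x) (.glue S hS y)

theorem lim_below_iff {c : C} {s : ℕ → Name J c} {y : Name J c} :
    Below (lim s) y ↔ ∀ n, Below (s n) y :=
  ⟨fun h => by cases h; assumption, .lim⟩

theorem suc_below_suc_iff {c : C} {x y : Name J c} : Below (suc x) (suc y) ↔ Below x y :=
  ⟨fun h => by cases h; assumption, .suc_suc⟩

theorem suc_below_zero_iff {c : C} {x : Name J c} : Below (suc x) zero ↔ ⊥ ∈ J c :=
  ⟨fun h => by cases h; assumption, .suc_zero⟩

theorem suc_below_lim_iff {c : C} {x : Name J c} {s : ℕ → Name J c} :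
    Below (suc x) (lim s) ↔
      Locally J c fun _ f => ∃ n, Below (suc (x.restrict f)) ((s n).restrict f) := by
  constructor
  · intro h
    cases h with
    | suc_lim T hT i h => exact ⟨T, hT, fun d f hf => ⟨_, h d f hf⟩⟩
  · rintro ⟨T, hT, h⟩
    choose i h using h
    exact .suc_lim T hT i h

theorem suc_below_glue_iff {c : C} {x : Name J c} {S : Sieve c} {hS : S ∈ J c}
    {y : ∀ (d : C) (f : d ⟶ c), S f → Name J d} :
    Below (suc x) (glue S hS y) ↔
      Locally J c fun d f => ∃ hf : S f, Below (suc (x.restrict f)) (y d f hf) := by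
  constructor
  · intro h
    cases h with
    | suc_glue T hT hTS h => exact ⟨T, hT, fun d f hf => ⟨_, h d f hf⟩⟩
  · rintro ⟨T, hT, h⟩
    choose i h using h
    exact .suc_glue T hT i h

theorem glue_below_iff {c : C} {y : Name J c} {S : Sieve c} {hS : S ∈ J c}
    {x : ∀ (d : C) (f : d ⟶ c), S f → Name J d} :
    Below (glue S hS x) y ↔
      Locally J c fun d f => ∃ hf : S f, Below (x d f hf) (y.restrict f) := by
  constructor
  · intro h
    cases h with
    | glue T hT hTS h => exact ⟨T, hT, fun d f hf => ⟨_, h d f hf⟩⟩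
  · rintro ⟨T, hT, h⟩
    choose i h using h
    exact .glue T hT i h

namespace Below

theorem restrict {c : C} {x y : Name J c} (h : Below x y) {d : C} (g : d ⟶ c) :
    Below (x.restrict g) (y.restrict g) := by
  induction h generalizing d with
  | zero => exact .zero
  | lim _ ih => exact .lim fun n => ih n g
  | glue T hT hTS h _ =>
    refine .glue (T.pullback g) (J.pullback_stable g hT) (fun e f hf => hTS _ _ hf) fun e f hf => ?_
    rw [restrict_restrict]
    exact h e (f ≫ g) hf
  | suc_zero h => exact .suc_zero (bot_mem_of_hom g h)
  | suc_suc _ ih => exact .suc_suc (ih g)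
  | suc_lim T hT i h _ =>
    refine .suc_lim (T.pullback g) (J.pullback_stable g hT) (fun e f hf => i _ _ hf)
      fun e f hf => ?_
    rw [restrict_restrict, restrict_restrict]
    exact h e (f ≫ g) hf
  | suc_glue T hT hTS h _ =>
    refine .suc_glue (T.pullback g) (J.pullback_stable g hT) (fun e f hf => hTS _ _ hf)
      fun e f hf => ?_
    rw [restrict_restrict]
    exact h e (f ≫ g) hf

/-- The rules for `zero`, `lim` and `glue` on the left are invertible, so locality passes to
subterms; the rules for a successor below a limit or an amalgamation already contain a cover, which
absorbs the given one. -/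
theorem of_locally {c : C} {x y : Name J c}
    (h : Locally J c fun _ f => Below (x.restrict f) (y.restrict f)) : Below x y := by
  induction x with
  | zero => exact .zero
  | lim s ih => exact .lim fun n => ih n (h.mono fun d f h => lim_below_iff.1 h n)
  | glue S hS x _ =>
    refine glue_below_iff.2 (h.bind fun d f h => (glue_below_iff.1 h).mono fun e g h => ?_)
    simpa using h
  | suc x ih =>
    cases y with
    | zero => exact .suc_zero (Locally.bot_mem (h.mono fun d f h => suc_below_zero_iff.1 h))
    | suc y => exact .suc_suc (ih (h.mono fun d f h => suc_below_suc_iff.1 h))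
    | lim s =>
      refine suc_below_lim_iff.2 (h.bind fun d f h => (suc_below_lim_iff.1 h).mono fun e g h => ?_)
      simpa using h
    | glue S hS y =>
      refine suc_below_glue_iff.2
        (h.bind fun d f h => (suc_below_glue_iff.1 h).mono fun e g h => ?_)
      simpa using h

theorem of_bot_mem {c : C} {x y : Name J c} (h : ⊥ ∈ J c) : Below x y :=
  of_locally (.of_bot h)

/-- The successor case of cut elimination, by a second induction on the right-hand derivation. The
hypothesis ranges over all later stages because that derivation may pass to covers. -/
theorem suc_of_forall_trans {c : C} {x y z : Name J c} (h : Below (suc y) z)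
    (H : ∀ {d : C} (f : d ⟶ c) {z : Name J d}, Below (y.restrict f) z → Below (x.restrict f) z) :
    Below (suc x) z := by
  generalize hw : suc y = w at h
  induction h with
  | zero => nomatch hw
  | lim => nomatch hw
  | glue => nomatch hw
  | suc_zero h => exact of_bot_mem h
  | suc_suc h =>
    obtain ⟨⟩ := hw
    exact .suc_suc (by simpa using H (𝟙 _) (by simpa using h))
  | suc_lim T hT i h ih' =>
    obtain ⟨⟩ := hw
    exact .suc_lim T hT i fun d f hf => ih' d f hf (fun g z h => by
      simpa using H (g ≫ f) (by simpa using h)) rfl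
  | suc_glue T hT hTS h ih' =>
    obtain ⟨⟩ := hw
    exact .suc_glue T hT hTS fun d f hf => ih' d f hf (fun g z h => by
      simpa using H (g ≫ f) (by simpa using h)) rfl

/-- Cut elimination, by induction on the first derivation. The second inequality lives at an
arbitrary later stage, since subderivations occur on members of covers. -/
theorem trans_restrict {c : C} {x y : Name J c} (h : Below x y) {d : C} (g : d ⟶ c)
    {z : Name J d} (h' : Below (y.restrict g) z) : Below (x.restrict g) z := by
  induction h generalizing d with
  | zero => exact .zero
  | lim _ ih => exact .lim fun n => ih n g h'
  | glue T hT hTS _ ih =>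
    refine .glue (T.pullback g) (J.pullback_stable g hT) (fun e f hf => hTS _ _ hf) fun e f hf => ?_
    simpa using ih e (f ≫ g) hf (𝟙 e) (by simpa using h'.restrict f)
  | suc_zero h => exact of_bot_mem (bot_mem_of_hom g h)
  | suc_suc _ ih =>
    exact suc_of_forall_trans h' fun f z h => by simpa using ih (f ≫ g) (by simpa using h)
  | suc_lim T hT i _ ih =>
    refine of_locally ⟨_, J.pullback_stable g hT, fun e f hf => ?_⟩
    simpa using ih e (f ≫ g) hf (𝟙 e)
      (by simpa using (lim_below_iff.1 h' (i e (f ≫ g) hf)).restrict f)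
  | suc_glue T hT hTS _ ih =>
    refine of_locally
      (((glue_below_iff.1 h').and ⟨_, J.pullback_stable g hT, fun _ _ h => h⟩).mono ?_)
    rintro e f ⟨⟨_, h⟩, hf⟩
    simpa using ih e (f ≫ g) hf (𝟙 e) (by simpa using h)

theorem trans {c : C} {x y z : Name J c} (h : Below x y) (h' : Below y z) : Below x z := by
  simpa using h.trans_restrict (𝟙 c) (by simpa using h')

theorem lim_right {c : C} {x : Name J c} {s : ℕ → Name J c} (n : ℕ) (h : Below x (s n)) :
    Below x (.lim s) := by
  induction x with
  | zero => exact .zero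
  | suc x _ => exact suc_below_lim_iff.2 (.of_forall fun d f => ⟨n, h.restrict f⟩)
  | lim t ih => exact .lim fun m => ih m (lim_below_iff.1 h m)
  | glue S hS x ih =>
    obtain ⟨T, hT, h⟩ := glue_below_iff.1 h
    refine glue_below_iff.2 ⟨T, hT, fun d f hf => ?_⟩
    obtain ⟨hf', h⟩ := h d f hf
    exact ⟨hf', ih d f hf' (s := fun n => (s n).restrict f) h⟩

theorem addNat {c : C} {x y : Name J c} (h : Below x y) (n : ℕ) :
    Below (x.addNat n) (y.addNat n) := by
  induction n with
  | zero => exact h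
  | succ n ih => exact .suc_suc ih

end Below

/-! ### Denoting names and elementary properties of the order -/

/-- The names that denote, with the order of the subterms expressed by `Below`. -/
inductive WellFormed {J : GrothendieckTopology C} : {c : C} → Name J c → Prop where
  | zero {c : C} : WellFormed (.zero : Name J c)
  | suc {c : C} {x : Name J c} : WellFormed x → WellFormed (.suc x)
  | lim {c : C} {s : ℕ → Name J c} : Forces J c (.defined (.lim s)) →
      (∀ n, WellFormed (s n)) → (∀ n, Below (.suc (s n)) (s (n + 1))) → WellFormed (.lim s)
  | glue {c : C} {S : Sieve c} {hS : S ∈ J c} {x : ∀ (d : C) (f : d ⟶ c), S f → Name J d} :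
      Forces J c (.defined (.glue S hS x)) →
      (∀ (d : C) (f : d ⟶ c) (hf : S f), WellFormed (x d f hf)) →
      (∀ (d : C) (f : d ⟶ c) (hf : S f) (e : C) (g : e ⟶ d),
        Below ((x d f hf).restrict g) (x e (g ≫ f) (S.downward_closed hf g)) ∧
        Below (x e (g ≫ f) (S.downward_closed hf g)) ((x d f hf).restrict g)) →
      WellFormed (.glue S hS x)

/-- The two names denote the same element. -/
def Equiv {c : C} (x y : Name J c) : Prop := Below x y ∧ Below y x

namespace WellFormed

theorem restrict {c : C} {x : Name J c} (h : WellFormed x) {d : C} (g : d ⟶ c) :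
    WellFormed (x.restrict g) := by
  induction h generalizing d with
  | zero => exact .zero
  | suc _ ih => exact .suc (ih g)
  | lim h _ h' ih => exact .lim (Forces.restrict g h) (fun n => ih n g) fun n => (h' n).restrict g
  | @glue c S hS x h _ h' ih =>
    refine .glue (Forces.restrict g h) (fun e f hf => ?_) (fun e f hf e' f' => ?_)
    · simpa using ih e (f ≫ g) hf (𝟙 e)
    · have := h' e (f ≫ g) hf e' f'
      rwa [family_congr x (Category.assoc f' f g).symm] at this

/-- Limits and amalgamations carry their `Forces` derivation: recovering it from `Below` would need
completeness and antisymmetry, which themselves use this lemma. -/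
theorem defined {c : C} {x : Name J c} (h : WellFormed x) : Forces J c (.defined x) := by
  induction h with
  | zero => exact .zero_defined
  | suc _ ih => exact .suc_defined ih
  | lim h => exact h
  | glue h => exact h

theorem lim_term {c : C} {s : ℕ → Name J c} (h : WellFormed (Name.lim s)) (n : ℕ) :
    WellFormed (s n) := by
  cases h with
  | lim _ h _ => exact h n

theorem lim_suc_below {c : C} {s : ℕ → Name J c} (h : WellFormed (Name.lim s)) (n : ℕ) :
    Below (Name.suc (s n)) (s (n + 1)) := by
  cases h with
  | lim _ _ h => exact h n

theorem of_suc {c : C} {x : Name J c} (h : WellFormed (Name.suc x)) : WellFormed x := by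
  cases h with
  | suc h => exact h

theorem addNat {c : C} {x : Name J c} (h : WellFormed x) (n : ℕ) : WellFormed (x.addNat n) := by
  induction n with
  | zero => exact h
  | succ n ih => exact .suc ih

/-- A name is below an amalgamation if it is locally below the members of the family. -/
theorem below_glue {c : C} {x : Name J c} (hx : WellFormed x) {S : Sieve c} {hS : S ∈ J c}
    {y : ∀ (d : C) (f : d ⟶ c), S f → Name J d}
    (h : Locally J c fun d f => ∃ hf : S f, Below (x.restrict f) (y d f hf)) :
    Below x (Name.glue S hS y) := by
  induction hx with
  | zero => exact .zero
  | suc => exact suc_below_glue_iff.2 h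
  | lim _ _ _ ih =>
    exact .lim fun n => ih n (h.mono fun d f ⟨hf, h⟩ => ⟨hf, lim_below_iff.1 h n⟩)
  | @glue c T hT x _ _ hm ih =>
    refine glue_below_iff.2 ⟨T, hT, fun d f hf => ⟨hf, ih d f hf ?_⟩⟩
    refine (h.restrict f).mono fun e g ⟨hg, h⟩ => ⟨hg, .of_locally ?_⟩
    refine (glue_below_iff.1 h).mono fun e' g' ⟨hg', h⟩ => .trans ?_ h
    have := (hm d f hf e' (g' ≫ g)).1
    rwa [← restrict_restrict, family_congr x (Category.assoc g' g f)] at this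

end WellFormed
namespace WellFormed

variable {c : C} {x y z : Name J c}

theorem below_refl (h : WellFormed x) : Below x x := by
  induction h with
  | zero => exact .zero
  | suc _ ih => exact .suc_suc ih
  | lim _ _ _ ih => exact .lim fun n => (ih n).lim_right n
  | @glue c S hS x h hx hm ih =>
    refine glue_below_iff.2 ⟨S, hS, fun d f hf => ⟨hf, below_glue (hx d f hf) ?_⟩⟩
    exact .of_forall fun e g => ⟨S.downward_closed hf g, (hm d f hf e g).1⟩

theorem term_below_lim {s : ℕ → Name J c} (h : WellFormed (Name.lim s)) (n : ℕ) :
    Below (s n) (Name.lim s) :=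
  (h.lim_term n).below_refl.lim_right n

theorem below_suc (h : WellFormed x) : Below x (Name.suc x) := by
  induction h with
  | zero => exact .zero
  | suc _ ih => exact .suc_suc ih
  | lim h hs h' ih =>
    exact .lim fun n => (ih n).trans (.suc_suc (term_below_lim (.lim h hs h') n))
  | @glue c S hS x h hx hm ih =>
    refine glue_below_iff.2 ⟨S, hS, fun d f hf => ⟨hf, (ih d f hf).trans (.suc_suc ?_)⟩⟩
    exact below_glue (hx d f hf) (.of_forall fun e g => ⟨S.downward_closed hf g, (hm d f hf e g).1⟩)

theorem below_addNat_of_le (h : WellFormed x) {m n : ℕ} (hmn : m ≤ n) :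
    Below (x.addNat m) (x.addNat n) := by
  induction hmn with
  | refl => exact (h.addNat m).below_refl
  | step _ ih => exact ih.trans (h.addNat _).below_suc

theorem below_addNat (h : WellFormed x) (n : ℕ) : Below x (x.addNat n) :=
  h.below_addNat_of_le (Nat.zero_le n)

/-- Cancel a successor in `s n + 1 ≤ s (n + 1) ≤ y + 1`. -/
theorem lim_below_of_suc {s : ℕ → Name J c} (h : WellFormed (Name.lim s))
    (h' : Below (Name.lim s) (Name.suc y)) : Below (Name.lim s) y :=
  .lim fun n => suc_below_suc_iff.1 ((h.lim_suc_below n).trans (lim_below_iff.1 h' (n + 1)))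

theorem lim_below_of_addNat {s : ℕ → Name J c} (h : WellFormed (Name.lim s)) (n : ℕ)
    (h' : Below (Name.lim s) (y.addNat n)) : Below (Name.lim s) y := by
  induction n with
  | zero => exact h'
  | succ n ih => exact ih (h.lim_below_of_suc h')

theorem lim_addNat_below {s : ℕ → Name J c} (h : WellFormed (Name.lim s)) (m n : ℕ) :
    Below ((s m).addNat n) (s (m + n)) := by
  induction n with
  | zero => exact (h.lim_term m).below_refl
  | succ n ih => exact (Below.suc_suc ih).trans (h.lim_suc_below (m + n))

theorem lim_mono {s : ℕ → Name J c} (h : WellFormed (Name.lim s)) {m n : ℕ} (hmn : m ≤ n) :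
    Below (s m) (s n) := by
  obtain ⟨k, rfl⟩ := Nat.exists_eq_add_of_le hmn
  exact ((h.lim_term m).below_addNat k).trans (h.lim_addNat_below m k)

/-- The order is irreflexive. -/
theorem bot_mem_of_suc_below (hx : WellFormed x) (h : Below (Name.suc x) x) : ⊥ ∈ J c := by
  -- Inversion moves to a cover, while the induction hypothesis concerns subterms at the original
  -- stage; hence the quantification over restrictions.
  have key : ∀ {c : C} {x : Name J c}, WellFormed x → ∀ {d : C} (f : d ⟶ c),
      Below (Name.suc (x.restrict f)) (x.restrict f) → ⊥ ∈ J d := by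
    intro c x hx
    induction hx with
    | zero => exact fun f h => suc_below_zero_iff.1 h
    | suc _ ih => exact fun f h => ih f (suc_below_suc_iff.1 h)
    | lim h hs h' ih =>
      intro d f hf
      refine Locally.bot_mem ((suc_below_lim_iff.1 hf).mono fun e g ⟨n, hn⟩ => ?_)
      refine ih n (g ≫ f) (.trans (.suc_suc ?_) (by simpa using hn))
      simpa using (term_below_lim (.lim h hs h') n).restrict (g ≫ f)
    | @glue c S hS x h hx hm ih =>
      intro d f hf
      refine Locally.bot_mem ((suc_below_glue_iff.1 hf).mono fun e g ⟨hg, hn⟩ => ?_)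
      replace hg : S (g ≫ f) := hg
      rw [restrict_restrict] at hn
      refine ih _ (g ≫ f) hg (𝟙 e) (.trans (.suc_suc ?_) (by simpa using hn))
      rw [restrict_id]
      refine below_glue (hx _ _ hg) (.of_forall fun e' g' => ?_)
      exact ⟨S.downward_closed hg g', (hm _ _ hg e' g').1⟩
  exact key hx (𝟙 c) (by simpa using h)

end WellFormed

namespace Equiv

variable {c : C} {x y z : Name J c}

theorem refl (h : WellFormed x) : Equiv x x := ⟨h.below_refl, h.below_refl⟩

theorem symm (h : Equiv x y) : Equiv y x := ⟨h.2, h.1⟩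

theorem trans (h : Equiv x y) (h' : Equiv y z) : Equiv x z := ⟨h.1.trans h'.1, h'.2.trans h.2⟩

theorem restrict (h : Equiv x y) {d : C} (f : d ⟶ c) : Equiv (x.restrict f) (y.restrict f) :=
  ⟨h.1.restrict f, h.2.restrict f⟩

end Equiv

/-! ### Soundness and completeness of the cut-free order -/

/-- The interpretation of an atomic statement by `WellFormed` and `Below`. -/
def Atom.Holds {c : C} : Atom J c → Prop
  | .defined x => WellFormed x
  | .equal x y => WellFormed x ∧ WellFormed y ∧ Equiv x y
  | .le x y => WellFormed x ∧ WellFormed y ∧ Below x y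

theorem Atom.Holds.restrict {c : C} {a : Atom J c} (h : a.Holds) {d : C} (g : d ⟶ c) :
    (a.restrict g).Holds :=
  match a, h with
  | .defined _, h => WellFormed.restrict h g
  | .equal _ _, ⟨hx, hy, h⟩ => ⟨hx.restrict g, hy.restrict g, h.restrict g⟩
  | .le _ _, ⟨hx, hy, h⟩ => ⟨hx.restrict g, hy.restrict g, h.restrict g⟩

theorem Forces.holds {c : C} {a : Atom J c} (h : Forces J c a) : a.Holds := by
  induction h with
  | restrict g _ ih => exact ih.restrict g
  | zero_defined => exact .zero
  | suc_defined _ ih => exact .suc ih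
  | lim_defined h h' ih ih' => exact .lim (.lim_defined h h') ih fun n => (ih' n).2.2
  | glue_defined h h' ih ih' =>
    exact .glue (.glue_defined h h') ih fun d f hf e g => (ih' d f hf e g).2.2
  | @glue_eq c S hS x _ d f hf ih =>
    refine ⟨ih.restrict f, ?_, ?_, ?_⟩
    · cases ih with
      | glue _ h _ => exact h d f hf
    · cases ih with
      | glue _ _ h =>
        exact glue_below_iff.2 (.of_forall fun e g => ⟨S.downward_closed hf g, (h d f hf e g).2⟩)
    · cases ih with
      | glue _ h h' =>
        exact (h d f hf).below_glue
          (.of_forall fun e g => ⟨S.downward_closed hf g, (h' d f hf e g).1⟩)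
  | eq_refl _ ih => exact ⟨ih, ih, .refl ih⟩
  | eq_symm _ ih => exact ⟨ih.2.1, ih.1, ih.2.2.symm⟩
  | eq_trans _ _ ih ih' => exact ⟨ih.1, ih'.2.1, ih.2.2.trans ih'.2.2⟩
  | suc_eq _ ih =>
    exact ⟨.suc ih.1, .suc ih.2.1, .suc_suc ih.2.2.1, .suc_suc ih.2.2.2⟩
  | eq_local hS _ _ _ ih ih' h =>
    exact ⟨ih, ih', .of_locally ⟨_, hS, fun d f hf => (h d f hf).2.2.1⟩,
      .of_locally ⟨_, hS, fun d f hf => (h d f hf).2.2.2⟩⟩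
  | bisim S T hS hT i j _ _ _ _ ih ih' h h' =>
    refine ⟨ih, ih', .lim fun n => .of_locally ⟨_, hS n, fun d f hf => ?_⟩,
      .lim fun n => .of_locally ⟨_, hT n, fun d f hf => ?_⟩⟩
    · exact (h n d f hf).2.2.lim_right (s := fun n => Name.restrict _ f) _
    · exact (h' n d f hf).2.2.lim_right (s := fun n => Name.restrict _ f) _
  | le_congr _ _ _ ih ih' h =>
    exact ⟨ih.2.1, ih'.2.1, (ih.2.2.2.trans h.2.2).trans ih'.2.2.1⟩
  | le_local hS _ _ _ ih ih' h =>
    exact ⟨ih, ih', .of_locally ⟨_, hS, fun d f hf => (h d f hf).2.2⟩⟩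
  | le_trans _ _ ih ih' => exact ⟨ih.1, ih'.2.1, ih.2.2.trans ih'.2.2⟩
  | zero_le _ ih => exact ⟨.zero, ih, .zero⟩
  | suc_le_suc _ ih => exact ⟨.suc ih.1, .suc ih.2.1, .suc_suc ih.2.2⟩
  | le_lim n _ _ ih ih' => exact ⟨ih'.1, ih, ih'.2.2.lim_right n⟩
  | lim_le _ _ ih ih' => exact ⟨ih, (ih' 0).2.1, .lim fun n => (ih' n).2.2⟩

theorem forces_defined_iff {c : C} {x : Name J c} : Forces J c (.defined x) ↔ WellFormed x :=
  ⟨fun h => h.holds, fun h => h.defined⟩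

theorem WellFormed.glue_family {c : C} {S : Sieve c} {hS : S ∈ J c}
    {x : ∀ (d : C) (f : d ⟶ c), S f → Name J d} (h : WellFormed (Name.glue S hS x))
    {d : C} (f : d ⟶ c) (hf : S f) : WellFormed (x d f hf) := by
  cases h with
  | glue _ h _ => exact h d f hf

/-- Each rule of `Below` is derivable in `Forces`; a successor below zero is derived by locality
over the empty cover. -/
theorem Below.forces {c : C} {x y : Name J c} (h : Below x y) (hx : WellFormed x)
    (hy : WellFormed y) : Forces J c (.le x y) := by
  induction h with
  | zero => exact .zero_le hy.defined
  | lim _ ih => exact .lim_le hx.defined fun n => ih n (hx.lim_term n) hy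
  | glue T hT hTS _ ih =>
    refine .le_local hT hx.defined hy.defined fun d f hf => ?_
    have hf' := hx.glue_family f (hTS d f hf)
    exact .le_congr (.eq_symm (.glue_eq hx.defined d f (hTS d f hf)))
      (.eq_refl (hy.restrict f).defined) (ih d f hf hf' (hy.restrict f))
  | suc_zero h => exact .le_local h hx.defined hy.defined fun d f hf => hf.elim
  | suc_suc _ ih => exact .suc_le_suc (ih hx.of_suc hy.of_suc)
  | suc_lim T hT i _ ih =>
    refine .le_local hT hx.defined hy.defined fun d f hf => ?_
    exact .le_lim (s := fun n => Name.restrict _ f) (i d f hf) (hy.restrict f).defined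
      (ih d f hf (hx.restrict f) ((hy.lim_term _).restrict f))
  | suc_glue T hT hTS _ ih =>
    refine .le_local hT hx.defined hy.defined fun d f hf => ?_
    exact .le_congr (.eq_refl (hx.restrict f).defined)
      (.eq_symm (.glue_eq hy.defined d f (hTS d f hf)))
      (ih d f hf (hx.restrict f) (hy.glue_family f (hTS d f hf)))

theorem forces_le_iff {c : C} {x y : Name J c} :
    Forces J c (.le x y) ↔ WellFormed x ∧ WellFormed y ∧ Below x y :=
  ⟨fun h => h.holds, fun ⟨hx, hy, h⟩ => h.forces hx hy⟩

theorem forces_equal_of_locally {c : C} {x y : Name J c} (hx : WellFormed x) (hy : WellFormed y)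
    (h : Locally J c fun d f => Forces J d (.equal (x.restrict f) (y.restrict f))) :
    Forces J c (.equal x y) :=
  let ⟨_, hS, h⟩ := h
  .eq_local hS hx.defined hy.defined h

/-! ### Antisymmetry -/

/-- A name is an amalgamation. -/
def Name.IsGlue {c : C} : Name J c → Prop
  | .glue _ _ _ => True
  | _ => False

/-- Locally, every element is named by a point constructor. -/
theorem WellFormed.locally_not_isGlue {c : C} {x : Name J c} (hx : WellFormed x) :
    Locally J c fun d f =>
      ∃ y, ¬ y.IsGlue ∧ WellFormed y ∧ Forces J d (.equal (x.restrict f) y) := by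
  induction hx with
  | zero => exact .of_forall fun d f => ⟨_, id, .zero, .eq_refl .zero_defined⟩
  | suc h =>
    exact .of_forall fun d f => ⟨_, id, (h.restrict f).suc, .eq_refl (h.restrict f).suc.defined⟩
  | lim h hs h' =>
    have := WellFormed.lim h hs h'
    exact .of_forall fun d f =>
      ⟨_, id, this.restrict f, .eq_refl (this.restrict f).defined⟩
  | @glue c S hS x h hx hm ih =>
    refine Locally.bind ⟨S, hS, fun d f hf => hf⟩ fun d f hf => ?_
    refine (ih d f hf).mono fun e g ⟨y, hy, hy', h'⟩ => ⟨y, hy, hy', ?_⟩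
    rw [← restrict_restrict]
    exact .eq_trans (.restrict g (.glue_eq h d f hf)) h'

/-- Only a successor below a limit can be inverted to a term of the sequence, so the detour is `s n
+ 1 ≤ s (n + 1) ≤ lim t`. -/
theorem WellFormed.lim_below_lim {c : C} {s t : ℕ → Name J c} (hs : WellFormed (.lim s))
    (h : Below (.lim s) (.lim t)) (n : ℕ) :
    Locally J c fun _ f => ∃ m, Below ((s n).restrict f) ((t m).restrict f) :=
  (suc_below_lim_iff.1 ((hs.lim_suc_below n).trans (lim_below_iff.1 h (n + 1)))).mono
    fun _ f ⟨m, hm⟩ => ⟨m, ((hs.lim_term n).restrict f).below_suc.trans hm⟩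

theorem forces_equal_lim {c : C} {s t : ℕ → Name J c} (hs : WellFormed (.lim s))
    (ht : WellFormed (.lim t)) (h : Equiv (.lim s) (.lim t)) :
    Forces J c (.equal (.lim s) (.lim t)) := by
  choose S hS h₁ using hs.lim_below_lim h.1
  choose T hT h₂ using ht.lim_below_lim h.2
  choose i hi using h₁
  choose j hj using h₂
  exact .bisim S T hS hT i j hs.defined ht.defined
    (fun n d f hf => (hi n d f hf).forces ((hs.lim_term _).restrict f) ((ht.lim_term _).restrict f))
    (fun n d f hf => (hj n d f hf).forces ((ht.lim_term _).restrict f) ((hs.lim_term _).restrict f))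

/-- The order is antisymmetric. -/
theorem Equiv.forces {c : C} {x y : Name J c} (h : Equiv x y) (hx : WellFormed x)
    (hy : WellFormed y) : Forces J c (.equal x y) := by
  have key : ∀ {c : C} {x : Name J c}, WellFormed x → ∀ {d : C} (f : d ⟶ c) {y : Name J d},
      WellFormed y → Equiv (x.restrict f) y → Forces J d (.equal (x.restrict f) y) := by
    -- Reduction to a right-hand name that is not an amalgamation. Then equal head constructors
    -- compare by congruence or `bisim`, and different ones occur only where the empty sieve covers.
    have main : ∀ {c : C} {x : Name J c}, WellFormed x → ∀ {d : C} (f : d ⟶ c),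
        (∀ {e : C} (g : e ⟶ d) {y : Name J e},
        ¬ y.IsGlue → WellFormed y → Equiv (x.restrict (g ≫ f)) y →
        Forces J e (.equal (x.restrict (g ≫ f)) y)) → ∀ {y : Name J d},
        WellFormed y → Equiv (x.restrict f) y → Forces J d (.equal (x.restrict f) y) := by
      intro c x hx d f h y hy hxy
      refine forces_equal_of_locally (hx.restrict f) hy
        (hy.locally_not_isGlue.mono fun e g ⟨y', hy', hw, hyy'⟩ => ?_)
      rw [restrict_restrict]
      refine .eq_trans (h g hy' hw ?_) (.eq_symm hyy')
      rw [← restrict_restrict]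
      exact (hxy.restrict g).trans hyy'.holds.2.2
    have triv : ∀ {d : C} {y z : Name J d}, WellFormed y → WellFormed z → ⊥ ∈ J d →
        Forces J d (.equal y z) := fun hy hz h => forces_equal_of_locally hy hz (.of_bot h)
    have lim_suc : ∀ {d : C} {s : ℕ → Name J d} {y : Name J d}, WellFormed (.lim s) →
        WellFormed (.suc y) → Equiv (.lim s) (.suc y) → ⊥ ∈ J d := fun hs hy h =>
      hy.of_suc.bot_mem_of_suc_below (h.2.trans (hs.lim_below_of_suc h.1))
    have lim_zero : ∀ {d : C} {s : ℕ → Name J d}, WellFormed (.lim s) →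
        Equiv (.lim s) .zero → ⊥ ∈ J d := fun hs h =>
      suc_below_zero_iff.1 ((hs.lim_suc_below 0).trans (lim_below_iff.1 h.1 1))
    intro c x hx
    induction hx with
    | zero =>
      refine fun {d} f => main .zero f fun g y hy hw h => ?_
      cases y with
      | zero => exact .eq_refl .zero_defined
      | suc y => exact triv .zero hw (suc_below_zero_iff.1 h.2)
      | lim s => exact triv .zero hw (lim_zero hw h.symm)
      | glue => exact (hy trivial).elim
    | suc hx ih =>
      refine fun {d} f => main hx.suc f fun g y hy hw h => ?_
      cases y with
      | zero => exact triv (hx.suc.restrict _) hw (suc_below_zero_iff.1 h.1)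
      | suc y =>
        exact .suc_eq (ih (g ≫ f) hw.of_suc
          ⟨suc_below_suc_iff.1 h.1, suc_below_suc_iff.1 h.2⟩)
      | lim s => exact triv (hx.suc.restrict _) hw (lim_suc hw (hx.suc.restrict _) h.symm)
      | glue => exact (hy trivial).elim
    | @lim c s h hs h' =>
      have hl : WellFormed (.lim s) := .lim h hs h'
      refine fun {d} f => main hl f fun g y hy hw h => ?_
      cases y with
      | zero => exact triv (hl.restrict _) hw (lim_zero (hl.restrict _) h)
      | suc y => exact triv (hl.restrict _) hw (lim_suc (hl.restrict _) hw h)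
      | lim t => exact forces_equal_lim (hl.restrict _) hw h
      | glue => exact (hy trivial).elim
    | @glue c S hS x h hx hm ih =>
      intro d f y hy hxy
      have hg : WellFormed (.glue S hS x) := .glue h hx hm
      refine forces_equal_of_locally (hg.restrict f) hy
        ⟨_, J.pullback_stable f hS, fun e g hf => ?_⟩
      have := Forces.glue_eq (hg.restrict f).defined e g hf
      refine .eq_trans this ?_
      simpa using ih e (g ≫ f) hf (𝟙 e) (hy.restrict g)
        (by simpa using this.holds.2.2.symm.trans (hxy.restrict g))
  simpa using key hx (𝟙 c) hy (by simpa using h)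

/-! ### Normal forms: zero or a limit, plus a natural number -/

/-- The name is literally `zero` or a limit. -/
def Name.IsBase {c : C} : Name J c → Prop
  | .zero => True
  | .lim _ => True
  | _ => False

/-- The sequence of a limit; constantly `zero` for other names. -/
def Name.seq {c : C} : Name J c → ℕ → Name J c
  | .lim s, n => s n
  | _, _ => .zero

theorem Name.IsBase.restrict {c : C} {x : Name J c} (h : x.IsBase) {d : C} (f : d ⟶ c) :
    (x.restrict f).IsBase := by
  cases x <;> exact h

theorem Name.eq_zero_of_restrict {c : C} {x : Name J c} {d : C} {f : d ⟶ c}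
    (h : x.restrict f = .zero) : x = .zero := by
  cases x <;> first | rfl | cases h

@[simp]
theorem Name.restrict_seq {c : C} (x : Name J c) (n : ℕ) {d : C} (f : d ⟶ c) :
    (x.restrict f).seq n = (x.seq n).restrict f := by
  cases x <;> rfl

theorem WellFormed.seq {c : C} {x : Name J c} (h : WellFormed x) (n : ℕ) :
    WellFormed (x.seq n) := by
  cases x with
  | lim s => exact h.lim_term n
  | _ => exact .zero

theorem WellFormed.seq_mono {c : C} {x : Name J c} (h : WellFormed x) {m n : ℕ} (hmn : m ≤ n) :
    Below (x.seq m) (x.seq n) := by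
  cases x with
  | lim s => exact h.lim_mono hmn
  | _ => exact .zero

theorem WellFormed.bot_mem_of_lim_below_zero {c : C} {s : ℕ → Name J c}
    (h : WellFormed (Name.lim s)) (h' : Below (Name.lim s) .zero) : ⊥ ∈ J c :=
  suc_below_zero_iff.1 ((h.lim_suc_below 0).trans (lim_below_iff.1 h' 1))

/-- Every sequence term of a base is locally below a term of a larger base. -/
theorem WellFormed.seq_below_seq {c : C} {a b : Name J c} (ha : WellFormed a)
    (hb : b.IsBase) (h : Below a b) (n : ℕ) :
    Locally J c fun _ f => ∃ m, Below ((a.seq n).restrict f) ((b.seq m).restrict f) := by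
  cases a with
  | lim s =>
    cases b with
    | zero => exact .of_bot (ha.bot_mem_of_lim_below_zero h)
    | lim t => exact ha.lim_below_lim h n
    | suc => exact hb.elim
    | glue => exact hb.elim
  | _ => exact .of_forall fun d f => ⟨0, .zero⟩

theorem WellFormed.base_below_of_addNat {c : C} {a y : Name J c} (h : WellFormed a)
    (ha : a.IsBase) (n : ℕ) (h' : Below a (y.addNat n)) : Below a y := by
  cases a with
  | zero => exact .zero
  | lim s => exact h.lim_below_of_addNat n h'
  | suc => exact ha.elim
  | glue => exact ha.elim

/-- `y` equals `a + m`, and `a` is zero or a limit. -/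
structure IsNormalForm {c : C} (a : Name J c) (m : ℕ) (y : Name J c) : Prop where
  isBase : a.IsBase
  wellFormed : WellFormed a
  equiv : Equiv y (a.addNat m)

namespace IsNormalForm

variable {c : C} {a b y z : Name J c} {m n : ℕ}

theorem restrict (h : IsNormalForm a m y) {d : C} (f : d ⟶ c) :
    IsNormalForm (a.restrict f) m (y.restrict f) :=
  ⟨h.isBase.restrict f, h.wellFormed.restrict f, by simpa using h.equiv.restrict f⟩

theorem base_below (h : IsNormalForm a m y) : Below a y :=
  (h.wellFormed.below_addNat m).trans h.equiv.2

theorem mono (h : IsNormalForm a m y) (h' : IsNormalForm b n z) (hyz : Below y z) : Below a b :=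
  h.wellFormed.base_below_of_addNat h.isBase n ((h.base_below.trans hyz).trans h'.equiv.1)

end IsNormalForm

/-- Locally, every element is of the form `a + m` with `a` zero or a limit. -/
theorem WellFormed.locally_isNormalForm {c : C} {y : Name J c} (h : WellFormed y) :
    Locally J c fun _ f => ∃ a m, IsNormalForm a m (y.restrict f) := by
  induction h with
  | zero => exact .of_forall fun d f => ⟨Name.zero, 0, by exact trivial, .zero, .refl .zero⟩
  | suc _ ih =>
    exact ih.mono fun d f ⟨a, m, ha, hw, h⟩ =>
      ⟨a, m + 1, ha, hw, .suc_suc h.1, .suc_suc h.2⟩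
  | lim h hs h' =>
    have := WellFormed.lim h hs h'
    exact .of_forall fun d f =>
      ⟨(Name.lim _).restrict f, 0, by exact trivial, this.restrict f, .refl (this.restrict f)⟩
  | @glue c S hS x h hx hm ih =>
    refine Locally.bind ⟨S, hS, fun d f hf => hf⟩ fun d f hf => ?_
    refine (ih d f hf).mono fun e g ⟨a, m, ha, hw, h'⟩ => ⟨a, m, ha, hw, ?_⟩
    rw [← restrict_restrict]
    exact ((Forces.glue_eq h d f hf).holds.2.2.restrict g).trans h'

/-! ### Joins relative to multiples of ω -/

/-- The limit of `h n + n`. -/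
abbrev Name.limAdd {c : C} (h : ℕ → Name J c) : Name J c := .lim fun n => (h n).addNat n

/-- `IsJoin k y z w`: the element `w` is the join of `y` and `z` as far as comparisons with the
multiples `ω * j`, `j ≤ k`, are concerned. -/
def IsJoin : ℕ → ∀ {c : C}, Name J c → Name J c → Name J c → Prop
  | 0, _, _, _, w => WellFormed w ∧ Below w .zero
  | k + 1, c, y, z, w => WellFormed w ∧ Locally J c fun d f => ∃ (a b : Name J d) (m n : ℕ),
      IsNormalForm a m (y.restrict f) ∧ IsNormalForm b n (z.restrict f) ∧
      ((a = .zero ∧ b = .zero ∧ Equiv (w.restrict f) .zero) ∨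
        (¬ (a = .zero ∧ b = .zero) ∧ ∃ h : ℕ → Name J d,
          (∀ i, IsJoin k (a.seq i) (b.seq i) (h i)) ∧ WellFormed (limAdd h) ∧
          Equiv (w.restrict f) (limAdd h)))

namespace IsJoin

variable {c : C} {y z w y' z' w' : Name J c} {k : ℕ}

theorem wellFormed (h : IsJoin k y z w) : WellFormed w := by
  cases k <;> exact h.1

theorem restrict (h : IsJoin k y z w) {d : C} (f : d ⟶ c) :
    IsJoin k (y.restrict f) (z.restrict f) (w.restrict f) := by
  cases k with
  | zero => exact ⟨h.1.restrict f, h.2.restrict f⟩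
  | succ k => exact ⟨h.1.restrict f, by simpa using h.2.restrict f⟩

theorem congr (h : IsJoin k y z w) (hw' : WellFormed w') (hw : Equiv w w') : IsJoin k y z w' := by
  cases k with
  | zero => exact ⟨hw', hw.2.trans h.2⟩
  | succ k =>
    refine ⟨hw', h.2.mono ?_⟩
    rintro d f ⟨a, b, m, n, ha, hb, h⟩
    refine ⟨a, b, m, n, ha, hb, h.imp ?_ ?_⟩
    · exact fun ⟨h₁, h₂, h₃⟩ => ⟨h₁, h₂, (hw.restrict f).symm.trans h₃⟩
    · exact fun ⟨h₀, h, h₁, h₂, h₃⟩ => ⟨h₀, h, h₁, h₂, (hw.restrict f).symm.trans h₃⟩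

theorem of_locally (hw : WellFormed w)
    (h : Locally J c fun _ f => IsJoin k (y.restrict f) (z.restrict f) (w.restrict f)) :
    IsJoin k y z w := by
  cases k with
  | zero => exact ⟨hw, .of_locally (h.mono fun d f h => h.2)⟩
  | succ k =>
    refine ⟨hw, h.bind fun d f h => ?_⟩
    simpa using h.2

theorem mono (h : IsJoin k y z w) (h' : IsJoin k y' z' w') (hy : Below y y') (hz : Below z z') :
    Below w w' := by
  induction k generalizing c with
  | zero => exact h.2.trans .zero
  | succ k ih =>
    refine .of_locally ((h.2.and h'.2).mono ?_)
    rintro d f ⟨⟨a, b, m, n, ha, hb, h⟩, a', b', m', n', ha', hb', h'⟩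
    have haa := ha.mono ha' (hy.restrict f)
    have hbb := hb.mono hb' (hz.restrict f)
    obtain ⟨-, -, h⟩ | ⟨hab, t, ht, -, h⟩ := h
    · exact h.1.trans .zero
    obtain ⟨rfl, rfl, -⟩ | ⟨-, t', ht', -, h'⟩ := h'
    -- Here `a` or `b` is a limit below zero, which is absurd.
    · refine .of_bot_mem ?_
      cases a with
      | lim s => exact ha.wellFormed.bot_mem_of_lim_below_zero haa
      | zero =>
        cases b with
        | lim s => exact hb.wellFormed.bot_mem_of_lim_below_zero hbb
        | zero => exact (hab ⟨rfl, rfl⟩).elim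
        | suc => exact hb.isBase.elim
        | glue => exact hb.isBase.elim
      | suc => exact ha.isBase.elim
      | glue => exact ha.isBase.elim
    · refine (h.1.trans (.lim fun i => .of_locally ?_)).trans h'.2
      refine ((ha.wellFormed.seq_below_seq ha'.isBase haa i).and
        (hb.wellFormed.seq_below_seq hb'.isBase hbb i)).mono ?_
      rintro e g ⟨⟨p, hp⟩, q, hq⟩
      rw [restrict_addNat]
      -- Besides dominating `p` and `q`, the index must dominate `i`, so that the summand `i` is at
      -- most `r`.
      let r := max i (max p q)
      have hr : Below ((t i).restrict g) ((t' r).restrict g) := by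
        refine ih ((ht i).restrict g) ((ht' r).restrict g) (hp.trans ?_) (hq.trans ?_)
        · exact (ha'.wellFormed.seq_mono (by omega)).restrict g
        · exact (hb'.wellFormed.seq_mono (by omega)).restrict g
      refine .lim_right r ?_
      rw [restrict_addNat]
      exact (hr.addNat i).trans
        ((((ht' r).restrict g).wellFormed).below_addNat_of_le (by omega))

/-- Joins are unique, so it suffices to construct them locally. -/
theorem exists_of_locally
    (h : Locally J c fun _ f => ∃ w, IsJoin k (y.restrict f) (z.restrict f) w)
    (hy : WellFormed y) (hz : WellFormed z) : ∃ w, IsJoin k y z w := by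
  obtain ⟨S, hS, h⟩ := h
  choose x hx using h
  have hw : WellFormed (.glue S hS x) := by
    refine forces_defined_iff.1 (.glue_defined (fun d f hf => (hx d f hf).wellFormed.defined) ?_)
    intro d f hf e g
    have h₁ := (hx d f hf).restrict g
    have h₂ := hx e (g ≫ f) (S.downward_closed hf g)
    rw [restrict_restrict, restrict_restrict] at h₁
    have ry := (hy.restrict (g ≫ f)).below_refl
    have rz := (hz.restrict (g ≫ f)).below_refl
    exact Equiv.forces ⟨h₁.mono h₂ ry rz, h₂.mono h₁ ry rz⟩ h₁.wellFormed h₂.wellFormed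
  refine ⟨_, of_locally hw ⟨S, hS, fun d f hf => ?_⟩⟩
  exact (hx d f hf).congr (hw.restrict f) (Forces.glue_eq hw.defined d f hf).holds.2.2.symm

/-- The join must exist at the stage itself: the next level needs the joins of all the pairs of
terms at one stage, whereas local existence would give a separate cover for each index. -/
theorem exists_isJoin (k : ℕ) {c : C} {y z : Name J c} (hy : WellFormed y) (hz : WellFormed z) :
    ∃ w, IsJoin k y z w := by
  induction k generalizing c with
  | zero => exact ⟨.zero, .zero, .zero⟩
  | succ k ih =>
    refine exists_of_locally ((hy.locally_isNormalForm.and hz.locally_isNormalForm).mono ?_) hy hz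
    rintro d f ⟨⟨a, m, ha⟩, b, n, hb⟩
    -- The test is on literal names, and restriction neither creates nor destroys a literal `zero`,
    -- so its outcome persists at later stages.
    by_cases hab : a = .zero ∧ b = .zero
    · refine ⟨.zero, .zero, .of_forall fun e g => ?_⟩
      exact ⟨_, _, m, n, ha.restrict g, hb.restrict g,
        .inl ⟨by rw [hab.1]; rfl, by rw [hab.2]; rfl, .refl .zero⟩⟩
    · choose t ht using fun i => ih (ha.wellFormed.seq i) (hb.wellFormed.seq i)
      have hl : WellFormed (limAdd t) := by
        refine forces_defined_iff.1 (.lim_defined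
          (fun i => ((ht i).wellFormed.addNat i).defined) fun i => ?_)
        refine Below.forces ?_ ((ht i).wellFormed.addNat i).suc ((ht _).wellFormed.addNat _)
        -- The joins of the terms are only weakly increasing; the summand `i` makes the sequence
        -- strictly increasing.
        exact .suc_suc (((ht i).mono (ht (i + 1)) (ha.wellFormed.seq_mono (Nat.le_succ i))
          (hb.wellFormed.seq_mono (Nat.le_succ i))).addNat i)
      refine ⟨limAdd t, hl, ⟨⊤, J.top_mem d, fun e g _ => ?_⟩⟩
      refine ⟨_, _, m, n, ha.restrict g, hb.restrict g, .inr ⟨?_, fun i => (t i).restrict g,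
        fun i => by simpa using (ht i).restrict g, by simpa using hl.restrict g,
        by simpa using Equiv.refl (hl.restrict g)⟩⟩
      exact fun ⟨h₁, h₂⟩ => hab ⟨eq_zero_of_restrict h₁, eq_zero_of_restrict h₂⟩

end IsJoin

/-! ### Multiples of ω below limits -/

section

variable {c : C}

theorem WellFormed.omegaMul (k : ℕ) : WellFormed (omegaMul k : Name J c) := by
  induction k with
  | zero => exact .zero
  | succ k ih =>
    exact forces_defined_iff.1 (.lim_defined (fun n => (ih.addNat n).defined) fun n =>
      Below.forces (ih.addNat n).suc.below_refl (ih.addNat n).suc (ih.addNat (n + 1)))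

theorem isBase_omegaMul (k : ℕ) : (omegaMul k : Name J c).IsBase := by
  cases k <;> exact trivial

theorem omegaMul_below_of_addNat {k n : ℕ} {y : Name J c}
    (h : Below (omegaMul k) (y.addNat n)) : Below (omegaMul k) y :=
  (WellFormed.omegaMul k).base_below_of_addNat (isBase_omegaMul k) n h

/-- `ω·k + m ≤ s n + m ≤ s (n + m)` for every `m`. -/
theorem omegaMul_succ_below_lim {k n : ℕ} {s : ℕ → Name J c} (hs : WellFormed (.lim s))
    (h : Below (omegaMul k) (s n)) : Below (omegaMul (k + 1)) (.lim s) :=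
  .lim fun m => ((h.addNat m).trans (hs.lim_addNat_below n m)).lim_right (n + m)

theorem locally_of_suc_omegaMul_below_lim {k : ℕ} {s : ℕ → Name J c}
    (h : Below (.suc (omegaMul k)) (.lim s)) :
    Locally J c fun _ f => ∃ n, Below (omegaMul k) ((s n).restrict f) :=
  (suc_below_lim_iff.1 h).mono fun d f ⟨n, h⟩ =>
    ⟨n, (WellFormed.omegaMul k).below_suc.trans (by simpa using h)⟩

theorem addNat_omegaMul_below_succ (k n : ℕ) :
    Below ((omegaMul k : Name J c).addNat n) (omegaMul (k + 1)) :=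
  (WellFormed.omegaMul (k + 1)).term_below_lim n

theorem locally_of_omegaMul_succ_below_lim {k : ℕ} {s : ℕ → Name J c}
    (h : Below (omegaMul (k + 1)) (.lim s)) :
    Locally J c fun _ f => ∃ n, Below (omegaMul k) ((s n).restrict f) :=
  locally_of_suc_omegaMul_below_lim ((addNat_omegaMul_below_succ k 1).trans h)

end

namespace IsJoin

variable {c : C} {y z w : Name J c} {k : ℕ}

theorem symm (h : IsJoin k y z w) : IsJoin k z y w := by
  induction k generalizing c with
  | zero => exact h
  | succ k ih =>
    refine ⟨h.1, h.2.mono ?_⟩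
    rintro d f ⟨a, b, m, n, ha, hb, h⟩
    refine ⟨b, a, n, m, hb, ha, h.imp (fun ⟨h₁, h₂, h₃⟩ => ⟨h₂, h₁, h₃⟩) ?_⟩
    exact fun ⟨h₀, t, ht, h⟩ => ⟨fun h => h₀ h.symm, t, fun i => ih (ht i), h⟩

/-- If `ω·(k+1) ≤ a`, then locally some term of `a` is above `ω·k`; by induction so is the
corresponding term of the join, and one such term suffices for a limit. -/
theorem omegaMul_below_of_left (h : IsJoin k y z w) (hy : Below (omegaMul k) y) :
    Below (omegaMul k) w := by
  induction k generalizing c with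
  | zero => exact .zero
  | succ k ih =>
    refine .of_locally (h.2.bind ?_)
    rintro d f ⟨a, b, m, n, ha, hb, h⟩
    have hy' : Below (Name.omegaMul (k + 1)) a :=
      omegaMul_below_of_addNat ((by simpa using hy.restrict f : Below _ _).trans ha.equiv.1)
    cases a with
    | zero => exact .of_bot ((WellFormed.omegaMul (k + 1)).bot_mem_of_lim_below_zero hy')
    | lim s =>
      obtain ⟨⟨⟩, -⟩ | ⟨-, t, ht, hl, h⟩ := h
      refine (locally_of_omegaMul_succ_below_lim hy').mono fun e g ⟨i, hi⟩ => ?_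
      rw [restrict_omegaMul, ← restrict_restrict]
      refine .trans (omegaMul_succ_below_lim (n := i) (hl.restrict g) ?_) (h.2.restrict g)
      rw [restrict_addNat]
      have := (ht i).restrict g
      exact (ih this hi).trans (this.wellFormed.below_addNat i)
    | suc => exact ha.isBase.elim
    | glue => exact ha.isBase.elim

/-- From `ω·(k+1) ≤ lim (h i + i)` one gets locally some `i` with `ω·k ≤ h i + i`, hence `ω·k ≤ h
i`, and the induction hypothesis splits this into a disjunction about the terms of `a` and `b`. -/
theorem locally_or (h : IsJoin k y z w) (hw : Below (omegaMul k) w) :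
    Locally J c fun _ f =>
      Below (omegaMul k) (y.restrict f) ∨ Below (omegaMul k) (z.restrict f) := by
  induction k generalizing c with
  | zero => exact .of_forall fun d f => .inl .zero
  | succ k ih =>
    refine h.2.bind ?_
    rintro d f ⟨a, b, m, n, ha, hb, h⟩
    have hw' : Below (Name.omegaMul (k + 1)) (w.restrict f) := by simpa using hw.restrict f
    obtain ⟨-, -, h⟩ | ⟨hab, t, ht, hl, h⟩ := h
    · exact .of_bot ((WellFormed.omegaMul (k + 1)).bot_mem_of_lim_below_zero (hw'.trans h.1))
    -- Passes from a term of the base back to the element. A zero base has the default term zero,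
    -- which is above `ω·k` when `k = 0`; that case must be excluded by hypothesis.
    have key : ∀ {e : C} (g : e ⟶ d) {a' x : Name J d} {m' i : ℕ}, IsNormalForm a' m' x →
        (k = 0 → a' ≠ .zero) → Below (Name.omegaMul k) ((a'.seq i).restrict g) →
        Locally J e fun _ g' => Below (Name.omegaMul (k + 1)) (x.restrict (g' ≫ g)) := by
      intro e g a' x m' i hx hk h
      cases a' with
      | zero =>
        cases k with
        | zero => exact (hk rfl rfl).elim
        | succ k => exact .of_bot ((WellFormed.omegaMul (k + 1)).bot_mem_of_lim_below_zero h)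
      | lim s =>
        refine .of_forall fun e' g' => ?_
        have := (omegaMul_succ_below_lim (hx.wellFormed.restrict g) h).trans
          (hx.base_below.restrict g)
        simpa using this.restrict g'
      | suc => exact hx.isBase.elim
      | glue => exact hx.isBase.elim
    -- At level one the terms carry no information; a base that is not literally zero is a limit,
    -- hence above ω.
    by_cases hk : k = 0
    · subst hk
      by_cases h₀ : a = .zero
      · simpa using (key (𝟙 d) (i := 0) hb (fun _ h => hab ⟨h₀, h⟩) .zero).mono
          fun e g h => Or.inr h
      · simpa using (key (𝟙 d) (i := 0) ha (fun _ => h₀) .zero).mono fun e g h => Or.inl h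
    refine (locally_of_omegaMul_succ_below_lim (hw'.trans h.1)).bind fun e g ⟨i, hi⟩ => ?_
    rw [restrict_addNat] at hi
    refine (ih ((ht i).restrict g) (omegaMul_below_of_addNat hi)).bind fun e' g' h => ?_
    rw [restrict_restrict, restrict_restrict] at h
    obtain h | h := h
    · exact (key (g' ≫ g) ha (fun h => (hk h).elim) h).mono fun _ _ h => .inl (by simpa using h)
    · exact (key (g' ≫ g) hb (fun h => (hk h).elim) h).mono fun _ _ h => .inr (by simpa using h)

end IsJoin
-- Translation between the thresholds `ω·k + (n + 1)` and `ω·(k + 1)`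
-- No limit lies strictly between `ω·k` and `ω·(k+1)`.
theorem IsNormalForm.omegaMul_succ_below {c : C} {a y : Name J c} {m k n : ℕ}
    (h : IsNormalForm a m y) (h' : Below ((omegaMul k).addNat (n + 1)) a) :
    Below (omegaMul (k + 1)) a := by
  replace h' : Below (.suc (omegaMul k)) a :=
    (Below.suc_suc ((WellFormed.omegaMul k).below_addNat n)).trans h'
  cases a with
  | zero => exact .of_bot_mem (suc_below_zero_iff.1 h')
  | lim s =>
    refine .of_locally ((locally_of_suc_omegaMul_below_lim h').mono fun d f ⟨n, hn⟩ => ?_)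
    rw [restrict_omegaMul]
    exact omegaMul_succ_below_lim (h.wellFormed.restrict f) hn
  | suc => exact h.isBase.elim
  | glue => exact h.isBase.elim

theorem addNat_below_of_addNat_add {c : C} {x y : Name J c} {i m : ℕ}
    (h : Below (x.addNat (i + m)) (y.addNat m)) : Below (x.addNat i) y := by
  induction m with
  | zero => exact h
  | succ m ih => exact ih (suc_below_suc_iff.1 h)

/-- Comparison with `ω * k + (n + 1)` amounts to comparison of another element with
`ω * (k + 1)`. -/
theorem WellFormed.locally_exists_omegaMul_succ_iff {c : C} {y : Name J c} (hy : WellFormed y)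
    (k n : ℕ) : Locally J c fun d f => ∃ y' : Name J d, WellFormed y' ∧ ∀ (e : C) (g : e ⟶ d),
      Below ((Name.omegaMul k).addNat (n + 1)) (y.restrict (g ≫ f)) ↔
        Below (Name.omegaMul (k + 1)) (y'.restrict g) := by
  refine hy.locally_isNormalForm.mono fun d f ⟨a, m, h⟩ => ?_
  have hy' := hy.restrict f
  by_cases hm : n + 1 ≤ m
  -- With `m ≥ n + 1` the condition on `a + m` is just `ω·k ≤ a`, which is what `ω·(k+1) ≤ y + ω`
  -- expresses; the witness is `y + ω`.
  · have hl : WellFormed (.lim fun i => (y.restrict f).addNat i) :=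
      forces_defined_iff.1 (.lim_defined (fun n => (hy'.addNat n).defined) fun n =>
        Below.forces (hy'.addNat n).suc.below_refl (hy'.addNat n).suc (hy'.addNat (n + 1)))
    refine ⟨_, hl, fun e g => ⟨fun h' => ?_, fun h' => ?_⟩⟩
    · refine omegaMul_succ_below_lim (n := 0) (hl.restrict g) ?_
      rw [restrict_addNat, restrict_restrict]
      exact ((WellFormed.omegaMul k).below_addNat _).trans h'
    · refine .of_locally ((locally_of_omegaMul_succ_below_lim h').mono fun e' g' ⟨i, hi⟩ => ?_)
      simp only [restrict_addNat, restrict_omegaMul] at hi ⊢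
      have hn := (h.restrict g).restrict g'
      rw [restrict_restrict _ f g] at hn hi
      have hb := omegaMul_below_of_addNat ((omegaMul_below_of_addNat hi).trans hn.equiv.1)
      exact (hb.addNat (n + 1)).trans ((hn.wellFormed.below_addNat_of_le hm).trans hn.equiv.2)
  -- With `m ≤ n`, cancelling `m` leaves a positive finite part, so the base is strictly above `ω·k`
  -- and hence above `ω·(k+1)`; the witness is `y` itself.
  · refine ⟨_, hy', fun e g => ⟨fun h' => ?_, fun h' => ?_⟩⟩
    · have hn := h.restrict g
      rw [← restrict_restrict] at h'
      obtain ⟨i, hi⟩ : ∃ i, n + 1 = i + 1 + m := ⟨n - m, by omega⟩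
      rw [hi] at h'
      exact (hn.omegaMul_succ_below (addNat_below_of_addNat_add (h'.trans hn.equiv.1))).trans
        hn.base_below
    · rw [restrict_restrict] at h'
      exact (addNat_omegaMul_below_succ k (n + 1)).trans h'

/-- Comparison with `ω * (k + 1)` amounts to comparison of another element with
`ω * k + (n + 1)`. -/
theorem WellFormed.locally_exists_omegaMul_addNat_iff {c : C} {y : Name J c} (hy : WellFormed y)
    (k n : ℕ) : Locally J c fun d f => ∃ y' : Name J d, WellFormed y' ∧ ∀ (e : C) (g : e ⟶ d),
      Below (Name.omegaMul (k + 1)) (y.restrict (g ≫ f)) ↔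
        Below ((Name.omegaMul k).addNat (n + 1)) (y'.restrict g) := by
  -- The witness is the base `a`: dropping `m` leaves the comparison with `ω·(k+1)` unchanged, and a
  -- base cannot tell the two thresholds apart.
  refine hy.locally_isNormalForm.mono fun d f ⟨a, m, h⟩ => ⟨a, h.wellFormed, fun e g => ?_⟩
  have hn := h.restrict g
  rw [restrict_restrict] at hn
  exact ⟨fun h' => (addNat_omegaMul_below_succ k (n + 1)).trans
      (omegaMul_below_of_addNat (h'.trans hn.equiv.1)),
    fun h' => (hn.omegaMul_succ_below h').trans hn.base_below⟩

/-! ### Representing disjunctions -/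

/-- At stage `c` and later, `w` is above `ω * k + n` precisely when `y` or `z` is. -/
def DecidesOr (k n : ℕ) {c : C} (y z w : Name J c) : Prop :=
  ∀ (d : C) (f : d ⟶ c), Below ((omegaMul k).addNat n) (w.restrict f) ↔
    Locally J d fun _ g => Below ((omegaMul k).addNat n) (y.restrict (g ≫ f)) ∨
      Below ((omegaMul k).addNat n) (z.restrict (g ≫ f))

theorem IsJoin.decidesOr {k : ℕ} {c : C} {y z w : Name J c} (h : IsJoin k y z w) :
    DecidesOr k 0 y z w := by
  refine fun d f => ⟨fun hw => by simpa [Name.addNat] using (h.restrict f).locally_or hw,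
    fun h' => .of_locally (h'.mono fun e g h' => ?_)⟩
  have hj := (h.restrict f).restrict g
  rw [restrict_restrict, restrict_restrict] at hj
  rw [restrict_addNat, restrict_omegaMul]
  exact h'.elim hj.omegaMul_below_of_left hj.symm.omegaMul_below_of_left

/-- Joins serve the thresholds `ω·k` directly. For a positive finite part both elements are
translated to the threshold `ω·(k+1)`, joined there, and the join is translated back. -/
theorem locally_exists_decidesOr (k n : ℕ) {c : C} {y z : Name J c} (hy : WellFormed y)
    (hz : WellFormed z) : Locally J c fun d f => ∃ w : Name J d, WellFormed w ∧
      DecidesOr k n (y.restrict f) (z.restrict f) w := by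
  cases n with
  | zero =>
    refine .of_forall fun d f => ?_
    obtain ⟨w, hw⟩ := IsJoin.exists_isJoin k (hy.restrict f) (hz.restrict f)
    exact ⟨w, hw.wellFormed, hw.decidesOr⟩
  | succ n =>
    refine ((hy.locally_exists_omegaMul_succ_iff k n).and
      (hz.locally_exists_omegaMul_succ_iff k n)).bind ?_
    rintro d f ⟨⟨y', hy', hyy⟩, z', hz', hzz⟩
    obtain ⟨w', hw'⟩ := IsJoin.exists_isJoin (k + 1) hy' hz'
    refine (hw'.wellFormed.locally_exists_omegaMul_addNat_iff k n).mono ?_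
    rintro e g ⟨w, hw, hww⟩
    refine ⟨w, hw, fun e' g' => ?_⟩
    rw [← hww e' g']
    refine (hw'.decidesOr e' (g' ≫ g)).trans ?_
    simp only [restrict_restrict, Name.addNat]
    have hyy' := fun {a : C} (i : a ⟶ e') => hyy a (i ≫ g' ≫ g)
    have hzz' := fun {a : C} (i : a ⟶ e') => hzz a (i ≫ g' ≫ g)
    simp only [Category.assoc, Name.addNat] at hyy' hzz' ⊢
    simp only [hyy', hzz']

theorem close_iff_locally {c : C} {P : Sieve c} {d : C} {f : d ⟶ c} :
    J.close P f ↔ Locally J d fun _ g => P (g ≫ f) :=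
  ⟨fun h => ⟨_, h, fun _ _ hg => hg⟩,
    fun ⟨_, hS, h⟩ => J.superset_covering (fun e g hg => h e g hg) hS⟩

theorem ordDecidable_iff {k n : ℕ} {c : C} {P : Sieve c} :
    OrdDecidable J ((omegaMul k).addNat n) P ↔ Locally J c fun d f => ∃ y : Name J d,
      WellFormed y ∧ ∀ (e : C) (g : e ⟶ d),
        P (g ≫ f) ↔ Below ((omegaMul k).addNat n) (y.restrict g) := by
  refine exists_congr fun S => and_congr_right fun _ => forall₃_congr fun d f _ =>
    exists_congr fun y => ?_
  rw [forces_defined_iff]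
  refine and_congr_right fun hy => forall₂_congr fun e g => ?_
  rw [forces_le_iff, restrict_addNat, restrict_omegaMul]
  simp [(WellFormed.omegaMul k).addNat n, hy.restrict g]

end Brouwer

theorem theorem6p4 {C : Type u} [CategoryTheory.Category.{v} C]
    (J : CategoryTheory.GrothendieckTopology C) (k n : ℕ) (c : C)
    (P Q : CategoryTheory.Sieve c) (hP : J.IsClosed P) (hQ : J.IsClosed Q)
    (hPd : Brouwer.OrdDecidable J ((Brouwer.Name.omegaMul k).addNat n) P)
    (hQd : Brouwer.OrdDecidable J ((Brouwer.Name.omegaMul k).addNat n) Q) :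
    Brouwer.OrdDecidable J ((Brouwer.Name.omegaMul k).addNat n) (J.close (P ⊔ Q)) := by
  rw [Brouwer.ordDecidable_iff] at hPd hQd ⊢
  refine (hPd.and hQd).bind ?_
  rintro d f ⟨⟨y, hy, hPy⟩, z, hz, hQz⟩
  refine (Brouwer.locally_exists_decidesOr k n hy hz).mono ?_
  rintro e g ⟨w, hw, h⟩
  refine ⟨w, hw, fun e' g' => ?_⟩
  rw [h, Brouwer.close_iff_locally]
  have hPy' := fun {a : C} (i : a ⟶ e') => hPy a (i ≫ g' ≫ g)
  have hQz' := fun {a : C} (i : a ⟶ e') => hQz a (i ≫ g' ≫ g)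
  simp only [CategoryTheory.Category.assoc] at hPy' hQz'
  simp only [CategoryTheory.Category.assoc, Brouwer.Name.restrict_restrict, ← hPy', ← hQz']
  rfl
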